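/- A word $w=w(x_1,\dots,x_m)$, $m\ge 1$, is a finite sequence, not necessarily reduced, of letters $x_i^{\pm1}$, $1\le i\le m$; its length $l(w)$ is the number of letters. For a group $G$ and $x_1,\dots,x_m\in G$ put $w_{\circ 1}(x_1,\dots,x_m)=w(x_1,\dots,x_m)$ and $w_{\circ (n+1)}(x_1,\dots,x_m)=w(w_{\circ n}(x_1,\dots,x_m),x_2,\dots,x_m)$ for $n\ge1$. The group $G$ satisfies the (Engel type) iterated identity $w$ if for all $x_1,\dots,x_m\in G$ there is $n\ge 1$ with $w_{\circ n}(x_1,\dots,x_m)=e$. Theorem. Let $w(x_1,\dots,x_m)$, $m\ge1$, be a word which is not freely equivalent to the empty word. Then there exists a finite group $G$ which does not satisfy the iterated identity $w$. Moreover, there exists a constant $C>0$ such that for every $m\ge 1$ and every word $w$ on $m$ letters which is not freely equivalent to the empty word, with $l=l(w)$: (1) there is a finite group $G$ with at most $\exp(l^C)$ elements which does not satisfy the iterated identity $w$; (2) there is a finite field $K$ with at most $\exp(l^C)$ elements such that $\mathrm{SL}(2,K)$ does not satisfy the iterated identity $w$ and such that, if $l\ge 2$, the group $\mathrm{SL}(2,K)$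 itself has at most $\exp(l^C)$ elements. -/

import Mathlib

/-- The value `w(x₁, …, x_m)` in the group `G` of the (not necessarily reduced) word `w`. A word is
a list of letters `(i, b)`, where `(i, true)` stands for `xᵢ` and `(i, false)` for `xᵢ⁻¹`; the
variables are indexed by `0, …, m - 1`. -/
def wordValue {m : ℕ} {G : Type*} [Group G] (w : List (Fin m × Bool)) (x : Fin m → G) : G :=
  (w.map fun a => if a.2 then x a.1 else (x a.1)⁻¹).prod

/-- The iterate `w_{∘n}(x₁, …, x_m)`: the word `w` is substituted `n` times for its own first
variable, the other variables staying fixed. The `0`-th iterate is `x₁`, the first is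
`w(x₁, …, x_m)`. -/
def wordIterate {m : ℕ} [NeZero m] {G : Type*} [Group G] (w : List (Fin m × Bool))
    (x : Fin m → G) : ℕ → G
  | 0 => x 0
  | n + 1 => wordValue w (Function.update x 0 (wordIterate w x n))

/-- `G` satisfies the Engel type iterated identity `w`: for all `x₁, …, x_m` in `G` there is
`n ≥ 1` with `w_{∘n}(x₁, …, x_m) = e`. -/
def SatisfiesIteratedIdentity {m : ℕ} [NeZero m] (G : Type*) [Group G]
    (w : List (Fin m × Bool)) : Prop :=
  ∀ x : Fin m → G, ∃ n : ℕ, 1 ≤ n ∧ wordIterate w x n = 1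

/-! Fix a field `F` with `q` elements, of characteristic two, and values in `SL₂(F)` for all
variables but the first. With adjugates in place of inverses, `w` becomes a polynomial self-map `P`
of the affine 4-space of 2 × 2 matrices. Suppose that over a finite extension `K` some matrix `y`
satisfies `y^(q) = P(y)` entrywise, with `det y` and the upper right entry nonzero. After scaling
`y` to determinant one, `w` acts on it as the `q`-Frobenius of `K`, which is injective and fixes the
other variables. All iterates are then Frobenius images of a nontrivial element, hence nontrivial
(`not_satisfies_of_frobenius`).

Such a `y` comes from `exists_maximal_notMem`. Let `h` be the product to be kept nonzero and `I` the
ideal of the `X i ^ q - P i`. Modulo `I`, composing with `P` is raising to the power `q`, so an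
algebraic relation between `h, h∘P, …, h∘Pⁿ` becomes a polynomial equation for `h` alone. If `h`
vanished at every such `y`, it would be nilpotent modulo `I`, and a power of `h∘Pⁿ` of degree below
`q` would lie in `I`. But `I` contains no nonzero polynomial of degree below `q`
(`eq_zero_of_mem_span`), so `h∘Pⁿ` would be zero.

That `h∘P⁴` is not zero is a statement about free groups: the fourth iterate of `w` is nontrivial
(`iterate_substitute_ne_one`), and a nontrivial element that is short compared to `q` has a nonzero
upper right entry somewhere in `SL₂(F)` (`exists_lift_entry_ne_zero`). Here `q` is polynomial in the
length, and `|K| ≤ q ^ q ^ 4`. -/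

open MvPolynomial in
/-- The polynomials all of whose monomials have total degree less than `N`. -/
noncomputable def MvPolynomial.degreeBelow (σ F : Type*) [CommRing F] (N : ℕ) : Submodule F (MvPolynomial σ F) :=
  restrictSupport F {d | d.degree < N}

/-! ### Polynomials modulo the relations `X i ^ q = P i`. -/

namespace FrobeniusTwist

open MvPolynomial

variable {σ F : Type*} [CommRing F]

theorem mem_degreeBelow {N : ℕ} {f : MvPolynomial σ F} :
    f ∈ degreeBelow σ F N ↔ ∀ d ∈ f.support, d.degree < N := by
  rw [degreeBelow, mem_restrictSupport_iff]
  rfl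

theorem degreeBelow_mono {M N : ℕ} (h : M ≤ N) : degreeBelow σ F M ≤ degreeBelow σ F N :=
  fun _ hf => mem_degreeBelow.2 fun d hd => (mem_degreeBelow.1 hf d hd).trans_le h

theorem mem_degreeBelow_totalDegree_succ (f : MvPolynomial σ F) :
    f ∈ degreeBelow σ F (f.totalDegree + 1) :=
  mem_degreeBelow.2 fun _ hd => Nat.lt_succ_of_le (le_totalDegree hd)

theorem mem_degreeBelow_of_totalDegree_lt {N : ℕ} {f : MvPolynomial σ F} (h : f.totalDegree < N) :
    f ∈ degreeBelow σ F N :=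
  degreeBelow_mono h (mem_degreeBelow_totalDegree_succ f)

theorem eq_zero_of_mem_degreeBelow_zero {f : MvPolynomial σ F} (h : f ∈ degreeBelow σ F 0) :
    f = 0 := by
  rw [← support_eq_empty, Finset.eq_empty_iff_forall_notMem]
  exact fun d hd => by simpa using mem_degreeBelow.1 h d hd

theorem mul_mem_degreeBelow {a b : ℕ} {f g : MvPolynomial σ F} (hf : f ∈ degreeBelow σ F a)
    (hg : g ∈ degreeBelow σ F (b + 1)) : f * g ∈ degreeBelow σ F (a + b) := by
  classical
  refine mem_degreeBelow.2 fun d hd => ?_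
  obtain ⟨d₁, h₁, d₂, h₂, rfl⟩ := Finset.mem_add.1 (support_mul f g hd)
  have := mem_degreeBelow.1 hf d₁ h₁
  have := mem_degreeBelow.1 hg d₂ h₂
  rw [map_add]
  omega

theorem monomial_mem_degreeBelow (e : σ →₀ ℕ) (c : F) :
    monomial e c ∈ degreeBelow σ F (e.degree + 1) := by
  refine mem_degreeBelow.2 fun d hd => ?_
  rw [Finset.mem_singleton.1 (support_monomial_subset hd)]
  exact Nat.lt_succ_self _

/-- `f` is the monomial with exponent `e` plus terms of smaller total degree. -/
def HasTop (f : MvPolynomial σ F) (e : σ →₀ ℕ) : Prop :=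
  f - monomial e 1 ∈ degreeBelow σ F e.degree

theorem HasTop.mem {f : MvPolynomial σ F} {e : σ →₀ ℕ} (h : HasTop f e) :
    f ∈ degreeBelow σ F (e.degree + 1) := by
  have := add_mem (degreeBelow_mono (Nat.le_succ _) h) (monomial_mem_degreeBelow e (1 : F))
  simpa using this

theorem hasTop_monomial (e : σ →₀ ℕ) : HasTop (monomial e (1 : F)) e := by
  simp [HasTop]

theorem HasTop.mul {f g : MvPolynomial σ F} {e e' : σ →₀ ℕ} (hf : HasTop f e) (hg : HasTop g e') :
    HasTop (f * g) (e + e') := by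
  have h : f * g - monomial (e + e') 1 =
      (f - monomial e 1) * g + (g - monomial e' 1) * monomial e 1 := by
    rw [← mul_one (1 : F), ← monomial_mul, mul_one]
    ring
  rw [HasTop, h, map_add]
  refine add_mem (mul_mem_degreeBelow hf hg.mem) ?_
  rw [add_comm]
  exact mul_mem_degreeBelow hg (monomial_mem_degreeBelow e 1)

theorem HasTop.pow {f : MvPolynomial σ F} {e : σ →₀ ℕ} (hf : HasTop f e) (n : ℕ) :
    HasTop (f ^ n) (n • e) := by
  induction n with
  | zero => simpa using hasTop_monomial (F := F) (0 : σ →₀ ℕ)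
  | succ n ih => rw [pow_succ, succ_nsmul]; exact ih.mul hf

theorem HasTop.prod {ι : Type*} (s : Finset ι) {f : ι → MvPolynomial σ F} {e : ι → σ →₀ ℕ}
    (h : ∀ i ∈ s, HasTop (f i) (e i)) : HasTop (∏ i ∈ s, f i) (∑ i ∈ s, e i) := by
  classical
  induction s using Finset.induction_on with
  | empty => simpa using hasTop_monomial (F := F) (0 : σ →₀ ℕ)
  | insert a s ha ih =>
    rw [Finset.prod_insert ha, Finset.sum_insert ha]
    exact (h a (Finset.mem_insert_self a s)).mul
      (ih fun i hi => h i (Finset.mem_insert_of_mem hi))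

theorem linearMap_ext_monomial {M : Type*} [AddCommGroup M] [Module F M]
    {f g : MvPolynomial σ F →ₗ[F] M} (h : ∀ e, f (monomial e 1) = g (monomial e 1)) : f = g :=
  (basisMonomials σ F).ext fun e => by simpa using h e

variable [Fintype σ]

/-- The monomial with exponent `e` in which every full `q`-th power `X i ^ q` is replaced by
`X i ^ q - P i`. -/
noncomputable def twistedMonomial (q : ℕ) (P : σ → MvPolynomial σ F) (e : σ →₀ ℕ) :
    MvPolynomial σ F :=
  monomial (e.mapRange (· % q) (Nat.zero_mod q)) 1 * ∏ i, (X i ^ q - P i) ^ (e i / q)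

/-- The linear map replacing every full `q`-th power `X i ^ q` by `X i ^ q - P i`. -/
noncomputable def twist (q : ℕ) (P : σ → MvPolynomial σ F) :
    MvPolynomial σ F →ₗ[F] MvPolynomial σ F :=
  (basisMonomials σ F).constr F (twistedMonomial q P)

theorem twist_monomial (q : ℕ) (P : σ → MvPolynomial σ F) (e : σ →₀ ℕ) :
    twist q P (monomial e 1) = twistedMonomial q P e := by
  have := (basisMonomials σ F).constr_basis F (twistedMonomial q P) e
  rwa [coe_basisMonomials] at this

theorem hasTop_twistedMonomial {q : ℕ} {P : σ → MvPolynomial σ F}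
    (hP : ∀ i, (P i).totalDegree < q) (e : σ →₀ ℕ) : HasTop (twistedMonomial q P e) e := by
  classical
  have hz : ∀ i, HasTop (X i ^ q - P i) (Finsupp.single i q) := fun i => by
    have h : X i ^ q - P i - monomial (Finsupp.single i q) 1 = -P i := by
      rw [X_pow_eq_monomial]; ring
    rw [HasTop, h, Finsupp.degree_single]
    exact neg_mem (mem_degreeBelow_of_totalDegree_lt (hP i))
  have := (hasTop_monomial (F := F) (e.mapRange (· % q) (Nat.zero_mod q))).mul
    (HasTop.prod Finset.univ fun i _ => (hz i).pow (e i / q))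
  have he : e.mapRange (· % q) (Nat.zero_mod q) + ∑ i, (e i / q) • Finsupp.single i q = e := by
    ext j
    simp [Finsupp.single_apply, Nat.mod_add_div']
  rwa [he] at this

/-- Since `deg P i < q`, `twist` is unitriangular for the filtration by total degree; this is what
makes it bijective. -/
theorem twist_sub_mem {q : ℕ} {P : σ → MvPolynomial σ F} (hP : ∀ i, (P i).totalDegree < q) {N : ℕ}
    {f : MvPolynomial σ F} (hf : f ∈ degreeBelow σ F (N + 1)) :
    twist q P f - f ∈ degreeBelow σ F N := by
  have h : twist q P f - f = ∑ d ∈ f.support, f.coeff d • (twistedMonomial q P d - monomial d 1) := by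
    conv_lhs => rw [f.as_sum, map_sum, ← Finset.sum_sub_distrib]
    refine Finset.sum_congr rfl fun d _ => ?_
    rw [← mul_one (coeff d f), ← smul_eq_mul, ← smul_monomial, map_smul, twist_monomial, smul_sub,
      smul_eq_mul, mul_one]
  rw [h]
  refine sum_mem fun d hd => Submodule.smul_mem _ _ ?_
  exact degreeBelow_mono (Nat.le_of_lt_succ (mem_degreeBelow.1 hf d hd)) (hasTop_twistedMonomial hP d)

theorem twist_injective {q : ℕ} {P : σ → MvPolynomial σ F} (hP : ∀ i, (P i).totalDegree < q) :
    Function.Injective (twist q P) := by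
  refine (injective_iff_map_eq_zero _).2 fun f hf => ?_
  have key : ∀ N, f ∈ degreeBelow σ F N → f = 0 := by
    intro N
    induction N with
    | zero => exact eq_zero_of_mem_degreeBelow_zero
    | succ N ih =>
      intro h
      have := neg_mem (twist_sub_mem hP h)
      rw [hf, zero_sub, neg_neg] at this
      exact ih this
  exact key _ (mem_degreeBelow_totalDegree_succ f)

theorem twist_surjective {q : ℕ} {P : σ → MvPolynomial σ F} (hP : ∀ i, (P i).totalDegree < q) :
    Function.Surjective (twist q P) := by
  have key : ∀ N, ∀ f ∈ degreeBelow σ F N, ∃ g, twist q P g = f := by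
    intro N
    induction N with
    | zero => exact fun f hf => ⟨0, by rw [eq_zero_of_mem_degreeBelow_zero hf, map_zero]⟩
    | succ N ih =>
      intro f hf
      obtain ⟨g, hg⟩ := ih _ (twist_sub_mem hP hf)
      exact ⟨f - g, by rw [map_sub, hg]; ring⟩
  exact fun f => key _ f (mem_degreeBelow_totalDegree_succ f)

theorem twistedMonomial_add_single {q : ℕ} (hq : 0 < q) (P : σ → MvPolynomial σ F) (e : σ →₀ ℕ)
    (i : σ) : twistedMonomial q P (e + Finsupp.single i q) =
      (X i ^ q - P i) * twistedMonomial q P e := by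
  classical
  have h1 : (e + Finsupp.single i q).mapRange (· % q) (Nat.zero_mod q) =
      e.mapRange (· % q) (Nat.zero_mod q) := by
    ext j
    by_cases h : i = j <;> simp [h]
  have h2 : ∏ j, (X j ^ q - P j) ^ ((e + Finsupp.single i q) j / q) =
      (∏ j, (X j ^ q - P j) ^ (e j / q)) * ∏ j, (X j ^ q - P j) ^ (if j = i then 1 else 0) := by
    rw [← Finset.prod_mul_distrib]
    refine Finset.prod_congr rfl fun j _ => ?_
    by_cases h : j = i
    · subst h; simp [Nat.add_div_right _ hq, pow_succ]
    · simp [h]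
  rw [twistedMonomial, twistedMonomial, h1, h2]
  simp only [pow_ite, pow_one, pow_zero, Finset.prod_ite_eq', Finset.mem_univ, if_true]
  ring

/-- Through this identity `twist` carries the monomial ideal of the `X i ^ q` onto the ideal of the
`X i ^ q - P i`. -/
theorem twist_X_pow_mul {q : ℕ} (hq : 0 < q) (P : σ → MvPolynomial σ F) (i : σ)
    (f : MvPolynomial σ F) : twist q P (X i ^ q * f) = (X i ^ q - P i) * twist q P f := by
  have h : (twist q P).comp (LinearMap.mulLeft F (X i ^ q)) =
      (LinearMap.mulLeft F (X i ^ q - P i)).comp (twist q P) := by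
    refine linearMap_ext_monomial fun e => ?_
    simp only [LinearMap.comp_apply, LinearMap.mulLeft_apply]
    rw [twist_monomial, ← twistedMonomial_add_single hq, ← twist_monomial, add_comm e, X_pow_eq_monomial,
      monomial_mul, mul_one]
  exact LinearMap.congr_fun h f

/-- A monomial with all exponents less than `q` is fixed by `twist`. -/
theorem twistedMonomial_of_lt {q : ℕ} (P : σ → MvPolynomial σ F) {e : σ →₀ ℕ} (he : ∀ i, e i < q) :
    twistedMonomial q P e = monomial e 1 := by
  have h1 : e.mapRange (· % q) (Nat.zero_mod q) = e := by
    ext j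
    simp [Nat.mod_eq_of_lt (he j)]
  rw [twistedMonomial, h1, Finset.prod_eq_one fun i _ => by rw [Nat.div_eq_of_lt (he i), pow_zero],
    mul_one]

/-- A nonzero polynomial of degree less than `q` does not lie in the ideal generated by the
polynomials `X i ^ q - P i`, where `P i` has degree less than `q`. -/
theorem eq_zero_of_mem_span {q : ℕ} (hq : 0 < q) {P : σ → MvPolynomial σ F}
    (hP : ∀ i, (P i).totalDegree < q) {g : MvPolynomial σ F}
    (hg : g ∈ Ideal.span (Set.range fun i => X i ^ q - P i)) (hdeg : g.totalDegree < q) : g = 0 := by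
  classical
  have hlt : ∀ d ∈ g.support, ∀ i, d i < q := fun d hd i =>
    ((Finsupp.le_degree i d).trans (le_totalDegree hd)).trans_lt hdeg
  have hfix : twist q P g = g := by
    conv_lhs => rw [g.as_sum]
    conv_rhs => rw [g.as_sum]
    rw [map_sum]
    refine Finset.sum_congr rfl fun d hd => ?_
    rw [← mul_one (coeff d g), ← smul_eq_mul, ← smul_monomial, map_smul, twist_monomial,
      twistedMonomial_of_lt P (hlt d hd)]
  obtain ⟨c, hc⟩ := (Ideal.mem_span_range_iff_exists_fun).1 hg
  choose h hh using fun i => twist_surjective hP (c i)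
  have hsum : g = ∑ i, X i ^ q * h i := by
    apply twist_injective hP
    rw [hfix, map_sum, ← hc]
    refine Finset.sum_congr rfl fun i _ => ?_
    rw [twist_X_pow_mul hq, hh, mul_comm]
  by_contra hne
  obtain ⟨d, hd⟩ := Finset.nonempty_iff_ne_empty.2 (fun h => hne (support_eq_empty.1 h))
  refine (mem_support_iff.1 hd) ?_
  rw [hsum, coeff_sum]
  refine Finset.sum_eq_zero fun i _ => ?_
  rw [X_pow_eq_monomial, coeff_monomial_mul', if_neg]
  intro hle
  have := hle i
  rw [Finsupp.single_eq_same] at this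
  exact absurd (hlt d hd i) (by omega)

open Classical in
/-- Modulo the polynomials `X i ^ q - P i` every polynomial is a combination of monomials with
exponents less than `q`. -/
theorem exists_reduced {q : ℕ} {P : σ → MvPolynomial σ F} (hP : ∀ i, (P i).totalDegree < q)
    {m : Ideal (MvPolynomial σ F)} (hm : ∀ i, X i ^ q - P i ∈ m) (g : MvPolynomial σ F) :
    ∃ c : (σ → Fin q) → F, Ideal.Quotient.mk m g =
      ∑ a, Ideal.Quotient.mk m (C (c a) * ∏ i, X i ^ (a i : ℕ)) := by
  classical
  obtain ⟨h, rfl⟩ := twist_surjective hP g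
  induction h using MvPolynomial.induction_on' with
  | add p r hp hr =>
    obtain ⟨c, hc⟩ := hp
    obtain ⟨c', hc'⟩ := hr
    refine ⟨c + c', ?_⟩
    rw [map_add, map_add, hc, hc', ← Finset.sum_add_distrib]
    simp [add_mul]
  | monomial e a =>
    have h0 : twist q P (monomial e a) = C a * twistedMonomial q P e := by
      rw [← mul_one a, ← smul_eq_mul, ← smul_monomial, map_smul, twist_monomial, smul_eq_C_mul,
        smul_eq_mul, mul_one]
    by_cases he : ∀ i, e i < q
    · refine ⟨Pi.single (fun i => ⟨e i, he i⟩) a, ?_⟩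
      rw [h0, twistedMonomial_of_lt P he, Finset.sum_eq_single (fun i => ⟨e i, he i⟩)]
      · rw [Pi.single_eq_same, monomial_eq, C_1, one_mul, Finsupp.prod_fintype _ _ (by simp)]
      · intro b _ hb
        simp [Pi.single_eq_of_ne hb]
      · simp
    · push Not at he
      obtain ⟨i, hi⟩ := he
      refine ⟨0, ?_⟩
      have hq : 0 < q := (Nat.zero_le _).trans_lt (hP i)
      have : Ideal.Quotient.mk m (twist q P (monomial e a)) = 0 := by
        rw [h0, twistedMonomial, Ideal.Quotient.eq_zero_iff_mem]
        refine m.mul_mem_left _ (m.mul_mem_left _ ?_)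
        rw [← Finset.mul_prod_erase _ _ (Finset.mem_univ i)]
        exact m.mul_mem_right _ (Ideal.pow_mem_of_mem m (hm i) _ (Nat.div_pos hi hq))
      rw [this]
      simp

theorem finite_quotient_and_card_le [Finite F] {q : ℕ} {P : σ → MvPolynomial σ F}
    (hP : ∀ i, (P i).totalDegree < q) {m : Ideal (MvPolynomial σ F)}
    (hm : ∀ i, X i ^ q - P i ∈ m) :
    Finite (MvPolynomial σ F ⧸ m) ∧
      Nat.card (MvPolynomial σ F ⧸ m) ≤ Nat.card F ^ q ^ Fintype.card σ := by
  classical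
  have hsurj : Function.Surjective fun c : (σ → Fin q) → F =>
      ∑ a, Ideal.Quotient.mk m (C (c a) * ∏ i, X i ^ (a i : ℕ)) := by
    intro x
    obtain ⟨g, rfl⟩ := Ideal.Quotient.mk_surjective x
    obtain ⟨c, hc⟩ := exists_reduced hP hm g
    exact ⟨c, hc.symm⟩
  refine ⟨Finite.of_surjective _ hsurj, (Nat.card_le_card_of_surjective _ hsurj).trans_eq ?_⟩
  simp [Nat.card_fun]

end FrobeniusTwist

/-! ### Points whose Frobenius image is their image under a polynomial map. -/

namespace FrobeniusTwist

open MvPolynomial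

variable {σ F : Type*} [Field F]

theorem totalDegree_bind₁_le {P : σ → MvPolynomial σ F} {d : ℕ} (hP : ∀ i, (P i).totalDegree ≤ d)
    (g : MvPolynomial σ F) : (bind₁ P g).totalDegree ≤ g.totalDegree * d := by
  conv_lhs => rw [g.as_sum, map_sum]
  refine totalDegree_finsetSum_le fun e he => ?_
  rw [bind₁_monomial]
  refine (totalDegree_mul _ _).trans ?_
  rw [totalDegree_C, zero_add]
  refine (totalDegree_finsetProd _ _).trans ?_
  calc ∑ i ∈ e.support, (P i ^ e i).totalDegree ≤ ∑ i ∈ e.support, e i * d :=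
        Finset.sum_le_sum fun i _ => (totalDegree_pow _ _).trans (Nat.mul_le_mul_left _ (hP i))
    _ = e.degree * d := by rw [← Finset.sum_mul]; rfl
    _ ≤ _ := Nat.mul_le_mul_right _ (le_totalDegree he)

theorem totalDegree_iterate_bind₁_le {P : σ → MvPolynomial σ F} {d : ℕ}
    (hP : ∀ i, (P i).totalDegree ≤ d) (g : MvPolynomial σ F) (j : ℕ) :
    ((bind₁ P)^[j] g).totalDegree ≤ g.totalDegree * d ^ j := by
  induction j with
  | zero => simp
  | succ j ih =>
    rw [Function.iterate_succ_apply', pow_succ, ← mul_assoc]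
    exact (totalDegree_bind₁_le hP _).trans (Nat.mul_le_mul_right _ ih)

/-- Modulo `X i ^ q - P i`, substituting `P` amounts to raising to the power `q`. -/
theorem mk_bind₁ [Fintype F] {P : σ → MvPolynomial σ F} {I : Ideal (MvPolynomial σ F)}
    (hI : ∀ i, X i ^ Fintype.card F - P i ∈ I) (g : MvPolynomial σ F) :
    Ideal.Quotient.mk I (bind₁ P g) = Ideal.Quotient.mk I g ^ Fintype.card F := by
  have h : (Ideal.Quotient.mkₐ F I).comp (bind₁ P) =
      (FiniteField.frobeniusAlgHom F (MvPolynomial σ F ⧸ I)).comp (Ideal.Quotient.mkₐ F I) := by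
    refine algHom_ext fun i => ?_
    simp only [AlgHom.comp_apply, bind₁_X_right, FiniteField.coe_frobeniusAlgHom,
      Ideal.Quotient.mkₐ_eq_mk]
    rw [← map_pow]
    exact (Ideal.Quotient.eq.2 (hI i)).symm
  exact AlgHom.congr_fun h g

theorem mk_iterate_bind₁ [Fintype F] {P : σ → MvPolynomial σ F} {I : Ideal (MvPolynomial σ F)}
    (hI : ∀ i, X i ^ Fintype.card F - P i ∈ I) (g : MvPolynomial σ F) (j : ℕ) :
    Ideal.Quotient.mk I ((bind₁ P)^[j] g) = Ideal.Quotient.mk I g ^ Fintype.card F ^ j := by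
  induction j with
  | zero => simp
  | succ j ih => rw [Function.iterate_succ_apply', mk_bind₁ hI, ih, ← pow_mul, pow_succ]

open Polynomial in
/-- A nonzero univariate polynomial whose value at an element `x` vanishes, where `x` lies in every
maximal ideal, forces a power of `x` to vanish. -/
theorem pow_eq_zero_of_aeval_eq_zero {A : Type*} [CommRing A] [Algebra F A] {x : A}
    (hx : ∀ M : Ideal A, M.IsMaximal → x ∈ M) {ρ : F[X]} (hρ : ρ ≠ 0) (h : aeval x ρ = 0) {N : ℕ}
    (hN : ρ.natDegree ≤ N) : x ^ N = 0 := by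
  obtain ⟨U, hU, hndvd⟩ := exists_eq_pow_rootMultiplicity_mul_and_not_dvd ρ hρ 0
  rw [Polynomial.C_0, sub_zero] at hU hndvd
  have hU0 : U.coeff 0 ≠ 0 := fun h0 => hndvd (X_dvd_iff.2 h0)
  -- Write `ρ = X ^ s * U` with `U(0) ≠ 0`. As `x` lies in the Jacobson radical, `U(x)` is a unit,
  -- so `x ^ s = 0`.
  have hunit : IsUnit (aeval x U) := by
    by_contra hn
    obtain ⟨M, hM, hmem⟩ := exists_max_ideal_of_mem_nonunits hn
    rw [← U.divX_mul_X_add, map_add, map_mul, Polynomial.aeval_X, Polynomial.aeval_C] at hmem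
    have h1 : algebraMap F A (U.coeff 0) ∈ M :=
      (Ideal.add_mem_iff_right M (M.mul_mem_left _ (hx M hM))).1 hmem
    exact hM.ne_top (M.eq_top_of_isUnit_mem h1 ((isUnit_iff_ne_zero.2 hU0).map _))
  have hs : ρ.rootMultiplicity 0 ≤ N := by
    classical
    refine le_trans ?_ hN
    rw [← count_roots]
    exact (Multiset.count_le_card _ _).trans (card_roots' ρ)
  have h2 : x ^ ρ.rootMultiplicity 0 = 0 := by
    rw [hU, map_mul, map_pow, Polynomial.aeval_X] at h
    exact (hunit.mul_left_eq_zero).1 h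
  exact pow_eq_zero_of_le hs h2

open Polynomial in
/-- If the exponents of a polynomial relation are digits, then substituting the powers `X ^ q ^ j`
gives a nonzero univariate polynomial. -/
theorem digit_polynomial_ne_zero {k D q : ℕ} (hDq : D + 1 ≤ q) {c : (Fin k → Fin (D + 1)) → F}
    (hc : c ≠ 0) : ∑ a, Polynomial.C (c a) * (X : F[X]) ^ (∑ j, (a j : ℕ) * q ^ (j : ℕ)) ≠ 0 := by
  classical
  obtain ⟨a₀, ha₀⟩ := Function.ne_iff.1 hc
  intro h
  apply ha₀
  -- Uniqueness of base `q` digits: distinct tuples give distinct exponents, so no terms merge.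
  have hinj : ∀ a : Fin k → Fin (D + 1),
      ∑ j, (a₀ j : ℕ) * q ^ (j : ℕ) = ∑ j, (a j : ℕ) * q ^ (j : ℕ) → a = a₀ := by
    intro a h
    have h1 : finFunctionFinEquiv (fun j => Fin.castLE hDq (a₀ j)) =
        finFunctionFinEquiv (fun j => Fin.castLE hDq (a j)) := by
      ext
      simpa [finFunctionFinEquiv_apply] using h
    have h2 := finFunctionFinEquiv.injective h1
    funext j
    exact ((Fin.castLE_injective hDq) (congrFun h2 j)).symm
  have h3 := congrArg (fun p => Polynomial.coeff p (∑ j, (a₀ j : ℕ) * q ^ (j : ℕ))) h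
  simp only [finsetSum_coeff, Polynomial.coeff_C_mul, Polynomial.coeff_X_pow, Polynomial.coeff_zero] at h3
  rw [Finset.sum_eq_single a₀] at h3
  · simpa using h3
  · intro b _ hb
    rw [if_neg fun h => hb (hinj b h), mul_zero]
  · simp

variable [Fintype σ]

/-- An algebraic relation, with bounded partial degrees, between polynomials whose number exceeds
the number of variables. -/
theorem exists_algebraic_relation {k D e : ℕ} (g : Fin k → MvPolynomial σ F)
    (hdeg : ∑ j, (g j).totalDegree ≤ e) (hcount : (D * e + 1) ^ Fintype.card σ < (D + 1) ^ k) :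
    ∃ c : (Fin k → Fin (D + 1)) → F, c ≠ 0 ∧ ∑ a, c a • ∏ j, g j ^ (a j : ℕ) = 0 := by
  classical
  let ev : ((Fin k → Fin (D + 1)) → F) →ₗ[F] MvPolynomial σ F :=
    Fintype.linearCombination F fun a => ∏ j, g j ^ (a j : ℕ)
  -- `Φ` reads only the coefficients with all exponents at most `D * e`. The degree bound shows that
  -- these are all the coefficients, so a kernel vector is a relation.
  let Φ : ((Fin k → Fin (D + 1)) → F) →ₗ[F] ((σ → Fin (D * e + 1)) → F) :=
    LinearMap.pi fun b => (lcoeff F (Finsupp.equivFunOnFinite.symm fun i => (b i : ℕ))).comp ev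
  have hΦ : LinearMap.ker Φ ≠ ⊥ := by
    refine LinearMap.ker_ne_bot_of_finrank_lt ?_
    simpa using hcount
  obtain ⟨c, hc, hc0⟩ := (Submodule.ne_bot_iff _).1 hΦ
  refine ⟨c, hc0, ?_⟩
  have hev : ev c = ∑ a, c a • ∏ j, g j ^ (a j : ℕ) := Fintype.linearCombination_apply F _ _
  rw [← hev]
  by_contra hne
  obtain ⟨d, hd⟩ := Finset.nonempty_iff_ne_empty.2 (fun h => hne (support_eq_empty.1 h))
  have hle : (ev c).totalDegree ≤ D * e := by
    rw [hev]
    refine totalDegree_finsetSum_le fun a _ => (totalDegree_smul_le _ _).trans ?_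
    refine (totalDegree_finsetProd _ _).trans ?_
    refine le_trans ?_ (Nat.mul_le_mul_left D hdeg)
    rw [Finset.mul_sum]
    exact Finset.sum_le_sum fun j _ =>
      (totalDegree_pow _ _).trans (Nat.mul_le_mul_right _ (Nat.le_of_lt_succ (a j).2))
  have hb : ∀ i, d i < D * e + 1 := fun i =>
    Nat.lt_succ_of_le (((Finsupp.le_degree i d).trans (le_totalDegree hd)).trans hle)
  refine mem_support_iff.1 hd ?_
  have := congrFun (LinearMap.mem_ker.1 hc) fun i => ⟨d i, hb i⟩
  have hd' : (Finsupp.equivFunOnFinite.symm fun i => d i) = d := by ext; simp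
  simpa [Φ, hd'] using this

/-- If a polynomial `h` does not vanish identically on the image of the `n`-th iterate of a
polynomial map `P` of affine `n`-space over a finite field with `q` elements, where `q` is large,
then it does not vanish at some point whose coordinatewise `q`-th power is its image under `P`. -/
theorem exists_maximal_notMem [Fintype F] {P : σ → MvPolynomial σ F} {d r : ℕ} (hd : 1 ≤ d)
    (hr : 1 ≤ r) (hP : ∀ i, (P i).totalDegree ≤ d) {h : MvPolynomial σ F} (hh : h.totalDegree ≤ r)
    (hne : (bind₁ P)^[Fintype.card σ] h ≠ 0)
    (hq : ((Fintype.card σ + 1) * (r * d ^ Fintype.card σ)) ^ (Fintype.card σ + 1) <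
      Fintype.card F) :
    (∀ i, (P i).totalDegree < Fintype.card F) ∧
    ∃ m : Ideal (MvPolynomial σ F), m.IsMaximal ∧
      (∀ i, X i ^ Fintype.card F - P i ∈ m) ∧ h ∉ m := by
  set n := Fintype.card σ with hn
  set q := Fintype.card F with hqdef
  set e := (n + 1) * (r * d ^ n) with he
  have hdn : 1 ≤ d ^ n := Nat.one_le_pow _ _ hd
  have hrd : 1 ≤ r * d ^ n := Nat.one_le_iff_ne_zero.2 (by positivity)
  have he1 : 1 ≤ e := Nat.one_le_iff_ne_zero.2 (by positivity)
  have hPq : ∀ i, (P i).totalDegree < q := fun i => by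
    have hn1 : n ≠ 0 := (Fintype.card_pos_iff.2 ⟨i⟩).ne'
    calc (P i).totalDegree ≤ d := hP i
      _ ≤ d ^ n := Nat.le_self_pow hn1 d
      _ ≤ r * d ^ n := Nat.le_mul_of_pos_left _ hr
      _ ≤ e := Nat.le_mul_of_pos_left _ (Nat.succ_pos n)
      _ ≤ e ^ (n + 1) := Nat.le_self_pow (Nat.succ_ne_zero n) e
      _ < q := hq
  refine ⟨hPq, ?_⟩
  by_contra! hcon
  set I := Ideal.span (Set.range fun i => X i ^ q - P i) with hIdef
  have hI : ∀ i, X i ^ q - P i ∈ I := fun i => Ideal.subset_span ⟨i, rfl⟩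
  -- With this `D` the unknowns outnumber the equations, while `D * e = e ^ (n + 1) < q` keeps the
  -- exponents valid base `q` digits.
  set D := e ^ n with hD
  have hdeg : ∑ j : Fin (n + 1), ((bind₁ P)^[(j : ℕ)] h).totalDegree ≤ e := by
    have : ∀ j : Fin (n + 1), ((bind₁ P)^[(j : ℕ)] h).totalDegree ≤ r * d ^ n := fun j =>
      (totalDegree_iterate_bind₁_le hP h j).trans
        (Nat.mul_le_mul hh (Nat.pow_le_pow_right hd (Nat.le_of_lt_succ j.2)))
    simpa [he] using Finset.sum_le_card_nsmul Finset.univ _ _ fun j _ => this j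
  have hcount : (D * e + 1) ^ n < (D + 1) ^ (n + 1) := by
    calc (D * e + 1) ^ n ≤ ((D + 1) * e) ^ n := Nat.pow_le_pow_left (by nlinarith) n
      _ = (D + 1) ^ n * D := by rw [mul_pow]
      _ < (D + 1) ^ n * (D + 1) := Nat.mul_lt_mul_of_pos_left (Nat.lt_succ_self D) (by positivity)
      _ = _ := (pow_succ _ _).symm
  obtain ⟨c, hc, hrel⟩ := exists_algebraic_relation _ hdeg hcount
  have hDe : D * e < q := by rwa [hD, ← pow_succ]
  have hDq : D + 1 ≤ q := (Nat.le_mul_of_pos_right D he1).trans_lt hDe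
  have hρ := digit_polynomial_ne_zero hDq hc
  have hx : ∀ M : Ideal (MvPolynomial σ F ⧸ I), M.IsMaximal → Ideal.Quotient.mk I h ∈ M := by
    intro M hM
    have hmax := Ideal.comap_isMaximal_of_surjective (Ideal.Quotient.mk I)
      Ideal.Quotient.mk_surjective (K := M)
    refine hcon _ hmax fun i => ?_
    rw [Ideal.mem_comap, Ideal.Quotient.eq_zero_iff_mem.2 (hI i)]
    exact M.zero_mem
  have haeval : Polynomial.aeval (Ideal.Quotient.mk I h)
      (∑ a, Polynomial.C (c a) * (Polynomial.X : Polynomial F) ^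
        (∑ j, (a j : ℕ) * q ^ (j : ℕ))) = 0 := by
    have := congrArg (Ideal.Quotient.mkₐ F I) hrel
    rw [map_sum, map_zero] at this
    rw [map_sum, ← this]
    refine Finset.sum_congr rfl fun a _ => ?_
    rw [map_mul, Polynomial.aeval_C, map_pow, Polynomial.aeval_X, map_smul,
      Algebra.smul_def (A := MvPolynomial σ F ⧸ I), map_prod, ← Finset.prod_pow_eq_pow_sum]
    congr 1
    refine Finset.prod_congr rfl fun j _ => ?_
    rw [map_pow, Ideal.Quotient.mkₐ_eq_mk, mk_iterate_bind₁ hI, ← pow_mul, mul_comm]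
  have hnat : (∑ a, Polynomial.C (c a) * (Polynomial.X : Polynomial F) ^
        (∑ j, (a j : ℕ) * q ^ (j : ℕ))).natDegree ≤ q ^ n * ((n + 1) * D) := by
    refine Polynomial.natDegree_sum_le_of_forall_le _ _ fun a _ => ?_
    refine (Polynomial.natDegree_C_mul_X_pow_le _ _).trans ?_
    have : ∀ j : Fin (n + 1), (a j : ℕ) * q ^ (j : ℕ) ≤ D * q ^ n := fun j =>
      Nat.mul_le_mul (Nat.le_of_lt_succ (a j).2)
        (Nat.pow_le_pow_right (by omega) (Nat.le_of_lt_succ j.2))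
    refine (Finset.sum_le_card_nsmul Finset.univ _ _ fun j _ => this j).trans_eq ?_
    simp
    ring
  have hpow := pow_eq_zero_of_aeval_eq_zero hx hρ haeval hnat
  -- The factor `q ^ n` of the exponent turns `h` into `h∘Pⁿ` modulo `I`. The remaining exponent `(n
  -- + 1) * D` leaves a degree of at most `D * e < q`.
  rw [pow_mul, ← mk_iterate_bind₁ hI, ← map_pow, Ideal.Quotient.eq_zero_iff_mem] at hpow
  have hzero := eq_zero_of_mem_span (by omega) hPq hpow (by
    refine (totalDegree_pow _ _).trans_lt (lt_of_le_of_lt ?_ hDe)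
    calc (n + 1) * D * ((bind₁ P)^[n] h).totalDegree ≤ (n + 1) * D * (r * d ^ n) :=
          Nat.mul_le_mul_left _ ((totalDegree_iterate_bind₁_le hP h n).trans
            (Nat.mul_le_mul_right _ hh))
      _ = D * e := by rw [he]; ring)
  exact hne (pow_eq_zero_iff (by positivity) |>.1 hzero)

end FrobeniusTwist

/-! ### Free groups acting by matrices over polynomials. -/

namespace FreeGroupMatrix

open Polynomial Matrix

variable {F : Type*} [Field F]

theorem natDegree_linear_mul_le {p : F[X]} {k : ℕ} (hp : p.natDegree ≤ k) (a b : F) :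
    ((C a * X + C b) * p).natDegree ≤ k + 1 := by
  refine natDegree_mul_le.trans ?_
  have := natDegree_linear_le (a := a) (b := b)
  omega

theorem coeff_linear_mul {p : F[X]} {k : ℕ} (hp : p.natDegree ≤ k) (a b : F) :
    ((C a * X + C b) * p).coeff (k + 1) = a * p.coeff k := by
  rw [add_mul, coeff_add, mul_assoc, coeff_C_mul, coeff_X_mul, coeff_C_mul,
    coeff_eq_zero_of_natDegree_lt (Nat.lt_succ_of_le hp), mul_zero, add_zero]

/-- A one-parameter family of matrices of determinant one whose leading coefficient has image
spanned by `(1, c)` and kernel spanned by `(1, c')`, and the other way round for the inverses. -/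
noncomputable def hyperbolicMatrix (c c' : F) : Matrix (Fin 2) (Fin 2) F[X] :=
  !![C c' * X + C (-(c + c') * (c' - c)⁻¹), C (-1) * X + C (2 * (c' - c)⁻¹);
    C (c * c') * X + C (-(c ^ 2 + c' ^ 2) * (c' - c)⁻¹), C (-c) * X + C ((c + c') * (c' - c)⁻¹)]

theorem det_hyperbolicMatrix {c c' : F} (h : c ≠ c') : (hyperbolicMatrix c c').det = 1 := by
  have hu : (C c' - C c) * C (c' - c)⁻¹ = (1 : F[X]) := by
    rw [← C_sub, ← C_mul, mul_inv_cancel₀ (sub_ne_zero.2 h.symm), C_1]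
  rw [hyperbolicMatrix, det_fin_two_of]
  simp only [C_mul, C_neg, C_add, C_pow, C_1, C_ofNat]
  linear_combination ((C c' - C c) * C (c' - c)⁻¹ + 1) * hu

/-- The family `hyperbolicMatrix` in the special linear group. -/
noncomputable def hyperbolic (c c' : F) (h : c ≠ c') : SpecialLinearGroup (Fin 2) F[X] :=
  ⟨hyperbolicMatrix c c', det_hyperbolicMatrix h⟩

/-- The vector `v` has entries of degree at most `k`, and `x` is its coefficient of degree `k`. -/
def HasLead (v : Fin 2 → F[X]) (k : ℕ) (x : Fin 2 → F) : Prop :=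
  ∀ i, (v i).natDegree ≤ k ∧ (v i).coeff k = x i

theorem HasLead.linear {v : Fin 2 → F[X]} {k : ℕ} {x : Fin 2 → F} (hv : HasLead v k x)
    (a b a' b' : F) :
    ((C a * X + C b) * v 0 + (C a' * X + C b') * v 1).natDegree ≤ k + 1 ∧
      ((C a * X + C b) * v 0 + (C a' * X + C b') * v 1).coeff (k + 1) = a * x 0 + a' * x 1 := by
  refine ⟨(natDegree_add_le _ _).trans (max_le ?_ ?_), ?_⟩
  · exact natDegree_linear_mul_le (hv 0).1 _ _
  · exact natDegree_linear_mul_le (hv 1).1 _ _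
  · rw [coeff_add, coeff_linear_mul (hv 0).1, coeff_linear_mul (hv 1).1, (hv 0).2, (hv 1).2]

theorem hasLead_hyperbolic_mulVec {c c' : F} (h : c ≠ c') {v : Fin 2 → F[X]} {k : ℕ}
    {x : Fin 2 → F} (hv : HasLead v k x) :
    HasLead ((hyperbolic c c' h : Matrix (Fin 2) (Fin 2) F[X]) *ᵥ v) (k + 1)
      ((c' * x 0 - x 1) • ![1, c]) := by
  have h0 := hv.linear c' (-(c + c') * (c' - c)⁻¹) (-1) (2 * (c' - c)⁻¹)
  have h1 := hv.linear (c * c') (-(c ^ 2 + c' ^ 2) * (c' - c)⁻¹) (-c) ((c + c') * (c' - c)⁻¹)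
  intro i
  fin_cases i
  · refine ⟨?_, Eq.trans ?_ (h0.2.trans ?_)⟩
    · simpa [hyperbolic, hyperbolicMatrix, mulVec, dotProduct] using h0.1
    · simp [hyperbolic, hyperbolicMatrix, mulVec, dotProduct]
    · simp; ring
  · refine ⟨?_, Eq.trans ?_ (h1.2.trans ?_)⟩
    · simpa [hyperbolic, hyperbolicMatrix, mulVec, dotProduct] using h1.1
    · simp [hyperbolic, hyperbolicMatrix, mulVec, dotProduct]
    · simp; ring

theorem hasLead_hyperbolic_inv_mulVec {c c' : F} (h : c ≠ c') {v : Fin 2 → F[X]} {k : ℕ}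
    {x : Fin 2 → F} (hv : HasLead v k x) :
    HasLead (((hyperbolic c c' h)⁻¹ : SpecialLinearGroup (Fin 2) F[X]).1 *ᵥ v) (k + 1)
      ((x 1 - c * x 0) • ![1, c']) := by
  have h0 := hv.linear (-c) ((c + c') * (c' - c)⁻¹) 1 (-(2 * (c' - c)⁻¹))
  have h1 := hv.linear (-(c * c')) ((c ^ 2 + c' ^ 2) * (c' - c)⁻¹) c' (-(c + c') * (c' - c)⁻¹)
  have hinv : ((hyperbolic c c' h)⁻¹ : SpecialLinearGroup (Fin 2) F[X]).1 =
      !![C (-c) * X + C ((c + c') * (c' - c)⁻¹), C 1 * X + C (-(2 * (c' - c)⁻¹));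
        C (-(c * c')) * X + C ((c ^ 2 + c' ^ 2) * (c' - c)⁻¹),
        C c' * X + C (-(c + c') * (c' - c)⁻¹)] := by
    change adjugate (hyperbolicMatrix c c') = _
    rw [hyperbolicMatrix, adjugate_fin_two_of]
    refine Matrix.ext fun i j => ?_
    fin_cases i <;> fin_cases j <;> simp only [C_neg, C_1, C_mul] <;> simp <;> ring
  rw [hinv]
  intro i
  fin_cases i
  · refine ⟨?_, Eq.trans ?_ (h0.2.trans ?_)⟩
    · simpa [mulVec, dotProduct] using h0.1
    · simp [mulVec, dotProduct]
    · simp; ring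
  · refine ⟨?_, Eq.trans ?_ (h1.2.trans ?_)⟩
    · simpa [mulVec, dotProduct] using h1.1
    · simp [mulVec, dotProduct]
    · simp; ring

variable {α : Type*}

/-- A homomorphism from the free group to matrices over polynomials, for distinct slopes `κ`. -/
noncomputable def hyperbolicRep (κ : α × Bool → F) (hκ : Function.Injective κ) :
    FreeGroup α →* SpecialLinearGroup (Fin 2) F[X] :=
  FreeGroup.lift fun i => hyperbolic (κ (i, true)) (κ (i, false)) (by simp [hκ.eq_iff])

theorem hasLead_letter_mulVec {κ : α × Bool → F} (hκ : Function.Injective κ) (a : α × Bool)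
    {v : Fin 2 → F[X]} {k : ℕ} {x : Fin 2 → F} (hv : HasLead v k x)
    (hx : κ (a.1, !a.2) * x 0 - x 1 ≠ 0) :
    ∃ μ : F, μ ≠ 0 ∧ HasLead ((hyperbolicRep κ hκ (FreeGroup.mk [a])).1 *ᵥ v) (k + 1)
      (μ • ![1, κ a]) := by
  obtain ⟨i, b⟩ := a
  cases b
  · refine ⟨x 1 - κ (i, true) * x 0, fun h => hx (by rw [Bool.not_false]; linear_combination -h), ?_⟩
    have : hyperbolicRep κ hκ (FreeGroup.mk [(i, false)]) =
        (hyperbolic (κ (i, true)) (κ (i, false)) (by simp [hκ.eq_iff]))⁻¹ := by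
      simp [hyperbolicRep]
    rw [this]
    exact hasLead_hyperbolic_inv_mulVec _ hv
  · refine ⟨κ (i, false) * x 0 - x 1, hx, ?_⟩
    have : hyperbolicRep κ hκ (FreeGroup.mk [(i, true)]) =
        hyperbolic (κ (i, true)) (κ (i, false)) (by simp [hκ.eq_iff]) := by
      simp [hyperbolicRep]
    rw [this]
    exact hasLead_hyperbolic_mulVec _ hv

/-- Ping-pong on leading coefficients: a letter sends the leading vector to its own slope and kills
only the slope of its inverse, which a reduced word never presents to it. The start vector `![0, 1]`
is vertical, so no letter kills it, and it extracts the second column. -/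
theorem hasLead_word_mulVec {κ : α × Bool → F} (hκ : Function.Injective κ) (a : α × Bool)
    (L : List (α × Bool)) (hL : FreeGroup.IsReduced (a :: L)) :
    ∃ μ : F, μ ≠ 0 ∧ HasLead ((hyperbolicRep κ hκ (FreeGroup.mk (a :: L))).1 *ᵥ ![0, 1])
      (L.length + 1) (μ • ![1, κ a]) := by
  induction L generalizing a with
  | nil =>
    refine hasLead_letter_mulVec hκ a (x := ![0, 1]) (fun i => ?_) (by simp)
    fin_cases i <;> simp
  | cons b L ih =>
    rw [FreeGroup.isReduced_cons_cons] at hL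
    obtain ⟨μ, hμ, h⟩ := ih b hL.2
    have hne : κ (a.1, !a.2) ≠ κ b := by
      rw [Ne, hκ.eq_iff]
      rintro rfl
      simpa using hL.1
    have hmul : FreeGroup.mk (a :: b :: L) = FreeGroup.mk [a] * FreeGroup.mk (b :: L) := by
      rw [FreeGroup.mul_mk]; rfl
    rw [hmul, map_mul]
    change ∃ μ : F, μ ≠ 0 ∧ HasLead (((hyperbolicRep κ hκ (FreeGroup.mk [a])).1 *
      (hyperbolicRep κ hκ (FreeGroup.mk (b :: L))).1) *ᵥ ![0, 1]) _ _
    rw [← mulVec_mulVec]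
    refine hasLead_letter_mulVec hκ a h ?_
    have : κ (a.1, !a.2) * (μ • ![1, κ b]) 0 - (μ • ![1, κ b]) 1 = μ * (κ (a.1, !a.2) - κ b) := by
      simp; ring
    rw [this]
    exact mul_ne_zero hμ (sub_ne_zero.2 hne)

/-- A nontrivial element of a free group takes a value with nonzero upper right entry in `SL₂` of
every finite field that is large compared to the number of generators and to the element. -/
theorem exists_lift_entry_ne_zero [Finite F] [DecidableEq α] {κ : α × Bool → F}
    (hκ : Function.Injective κ) {g : FreeGroup α} (hg : g ≠ 1) (hcard : g.norm < Nat.card F) :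
    ∃ x : α → SpecialLinearGroup (Fin 2) F, (FreeGroup.lift x g).1 0 1 ≠ 0 := by
  have := Fintype.ofFinite F
  obtain ⟨a, L, hL⟩ := List.exists_cons_of_ne_nil (fun h => hg (FreeGroup.toWord_eq_nil_iff.1 h))
  have hred : FreeGroup.IsReduced (a :: L) := hL ▸ FreeGroup.isReduced_toWord
  obtain ⟨μ, hμ, h⟩ := hasLead_word_mulVec hκ a L hred
  rw [← hL, FreeGroup.mk_toWord] at h
  set p := (hyperbolicRep κ hκ g).1 0 1 with hp
  have hlen : L.length + 1 = g.norm := by rw [FreeGroup.norm, hL]; rfl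
  have h0 := h 0
  have hp0 : ((hyperbolicRep κ hκ g).1 *ᵥ ![0, 1]) 0 = p := by simp [mulVec, dotProduct, hp]
  rw [hp0] at h0
  have hne : p ≠ 0 := by
    rintro h'
    rw [h'] at h0
    simp at h0
    exact hμ h0.symm
  -- The entry `p` has degree at most the norm of `g`, hence fewer roots than `F` has elements.
  obtain ⟨t, ht⟩ : ∃ t, p.eval t ≠ 0 := by
    by_contra! hcon
    refine hne (Polynomial.eq_zero_of_natDegree_lt_card_of_eval_eq_zero p (f := id)
      Function.injective_id hcon ?_)
    rw [← Nat.card_eq_fintype_card]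
    exact (h0.1.trans_eq hlen).trans_lt hcard
  refine ⟨fun i => SpecialLinearGroup.map (evalRingHom t)
    (hyperbolicRep κ hκ (FreeGroup.of i)), ?_⟩
  have hcomp : FreeGroup.lift (fun i => SpecialLinearGroup.map (evalRingHom t)
      (hyperbolicRep κ hκ (FreeGroup.of i))) =
      (SpecialLinearGroup.map (evalRingHom t)).comp (hyperbolicRep κ hκ) := by
    ext1 i
    simp
  rw [hcomp]
  exact ht

end FreeGroupMatrix

/-- In characteristic two every element of a finite field has exactly one square root, which serves
later to normalize determinants. -/
theorem exists_finite_field_charTwo (B : ℕ) (hB : 1 ≤ B) :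
    ∃ (F : Type) (_ : Field F), CharP F 2 ∧ B < Nat.card F ∧ Nat.card F ≤ 2 * B := by
  refine ⟨GaloisField 2 (Nat.log 2 B + 1), inferInstance, inferInstance, ?_, ?_⟩ <;>
    rw [GaloisField.card _ _ (Nat.succ_ne_zero _)]
  · exact Nat.lt_pow_succ_log_self (by norm_num) B
  · rw [pow_succ, mul_comm]
    exact Nat.mul_le_mul_left 2 (Nat.pow_log_le_self 2 (by omega))

theorem Function.exists_injective_of_card_le {A B : Type*} [Finite A] [Finite B]
    (h : Nat.card A ≤ Nat.card B) : ∃ f : A → B, Function.Injective f := by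
  have := Fintype.ofFinite A
  have := Fintype.ofFinite B
  rw [Nat.card_eq_fintype_card, Nat.card_eq_fintype_card] at h
  obtain ⟨f⟩ := Function.Embedding.nonempty_of_card_le h
  exact ⟨f, f.injective⟩

/-! ### Hopfian property of free groups and iterated substitution. -/

namespace FreeGroup

/-- Free groups of finite rank are residually finite. -/
theorem exists_finite_hom_ne_one {α : Type*} [Finite α] {g : FreeGroup α} (hg : g ≠ 1) :
    ∃ (H : Type) (_ : Group H) (_ : Finite H) (f : FreeGroup α →* H), f g ≠ 1 := by
  classical
  obtain ⟨F, _, -, hcard, -⟩ := exists_finite_field_charTwo (Nat.card (α × Bool) + g.norm + 1)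
    (by omega)
  have : Finite F := Nat.finite_of_card_ne_zero (by omega)
  obtain ⟨κ, hκ⟩ := Function.exists_injective_of_card_le (A := α × Bool) (B := F)
    (by omega)
  obtain ⟨x, hx⟩ := FreeGroupMatrix.exists_lift_entry_ne_zero hκ hg (by omega)
  refine ⟨Matrix.SpecialLinearGroup (Fin 2) F, inferInstance,
    Subtype.finite, FreeGroup.lift x, fun h => hx ?_⟩
  rw [h]
  simp

/-- Homomorphisms to the group of order two are counted: pulling back along `f` embeds `2 ^ β` into
`2 ^ α`. -/
theorem finite_and_card_le_of_surjective {α β : Type*} [Finite α] (f : FreeGroup α →* FreeGroup β)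
    (hf : Function.Surjective f) : Finite β ∧ Nat.card β ≤ Nat.card α := by
  classical
  have hinj : Function.Injective fun u : β → Multiplicative (ZMod 2) =>
      FreeGroup.lift.symm ((FreeGroup.lift u).comp f) := by
    intro u v h
    have h1 := FreeGroup.lift.symm.injective h
    exact FreeGroup.lift.injective ((MonoidHom.cancel_right hf).1 h1)
  have hfin : Finite (β → Multiplicative (ZMod 2)) := Finite.of_injective _ hinj
  have hβ : Finite β := Finite.of_injective
    (fun b : β => Pi.mulSingle (M := fun _ => Multiplicative (ZMod 2)) b (Multiplicative.ofAdd 1)) (by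
      intro b c h
      by_contra hne
      have := congrFun h b
      simp [Pi.mulSingle_eq_of_ne hne] at this)
  refine ⟨hβ, ?_⟩
  have := Nat.card_le_card_of_injective _ hinj
  rw [Nat.card_fun, Nat.card_fun] at this
  have h2 : Nat.card (Multiplicative (ZMod 2)) = 2 := by simp
  rw [h2] at this
  exact (Nat.pow_le_pow_iff_right (by norm_num)).1 this

/-- Free groups of finite rank are Hopfian. -/
theorem injective_of_surjective {α β : Type*} [Finite α] [Finite β]
    (hcard : Nat.card α = Nat.card β) (f : FreeGroup α →* FreeGroup β)
    (hf : Function.Surjective f) : Function.Injective f := by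
  refine (injective_iff_map_eq_one f).2 fun g hg => ?_
  by_contra hne
  obtain ⟨H, _, _, ψ, hψ⟩ := exists_finite_hom_ne_one hne
  -- Both free groups have equally many homomorphisms to the finite group `H`, so the injective
  -- pullback along `f` is onto. Thus `ψ` factors through `f` and must kill `g`.
  have hinj : Function.Injective fun u : β → H =>
      FreeGroup.lift.symm ((FreeGroup.lift u).comp f) := by
    intro u v h
    have h1 := FreeGroup.lift.symm.injective h
    exact FreeGroup.lift.injective ((MonoidHom.cancel_right hf).1 h1)
  have hsurj := (hinj.bijective_of_nat_card_le (by simp [Nat.card_fun, hcard])).2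
  obtain ⟨u, hu⟩ := hsurj (FreeGroup.lift.symm ψ)
  have h2 := FreeGroup.lift.symm.injective hu
  apply hψ
  rw [← h2, MonoidHom.comp_apply, hg, _root_.map_one]

variable {α : Type*} [DecidableEq α]

/-- The endomorphism of a free group that sends one generator `a` to `w` and fixes the others. -/
def substitute (a : α) (w : FreeGroup α) : FreeGroup α →* FreeGroup α :=
  FreeGroup.lift (Function.update FreeGroup.of a w)

@[simp]
theorem substitute_of_self (a : α) (w : FreeGroup α) : substitute a w (of a) = w := by
  simp [substitute]

theorem substitute_of_ne {a b : α} (h : b ≠ a) (w : FreeGroup α) :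
    substitute a w (of b) = of b := by
  simp [substitute, h]

theorem substitute_substitute_one (a : α) (w g : FreeGroup α) :
    substitute a w (substitute a 1 g) = substitute a 1 g := by
  have : (substitute a w).comp (substitute a 1) = substitute a 1 := by
    ext b
    by_cases h : b = a
    · subst h; simp
    · simp [substitute_of_ne h]
  exact DFunLike.congr_fun this g

/-- A substitution of one generator by `w` is injective unless `w` does not involve it. -/
theorem substitute_injective_or [Finite α] (a : α) (w : FreeGroup α) :
    Function.Injective (substitute a w) ∨ substitute a 1 w = w := by
  set φ := substitute a w with hφ
  -- By Nielsen–Schreier the image of `φ` is free. It is a quotient of a free group of rank `|α|`,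
  -- and `π`, which kills `a`, maps it onto one of rank `|α| - 1`; only two ranks remain.
  let e := IsFreeGroup.toFreeGroup φ.range
  let π : FreeGroup α →* FreeGroup {b : α // b ≠ a} :=
    FreeGroup.lift fun b => if h : b ≠ a then of ⟨b, h⟩ else 1
  have hπ_of : ∀ b : {b : α // b ≠ a}, π (of b) = of b := fun b => by simp [π, b.2]
  let f : FreeGroup α →* FreeGroup (IsFreeGroup.Generators φ.range) :=
    e.toMonoidHom.comp φ.rangeRestrict
  have hf : Function.Surjective f := e.surjective.comp φ.rangeRestrict_surjective
  let g : FreeGroup (IsFreeGroup.Generators φ.range) →* FreeGroup {b : α // b ≠ a} :=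
    (π.comp φ.range.subtype).comp e.symm.toMonoidHom
  have hgf : ∀ x, g (f x) = π (φ x) := fun x => by simp [g, f]
  have hg : Function.Surjective g := by
    have : Function.Surjective (g.comp f) := by
      intro y
      refine ⟨FreeGroup.lift (fun b : {b : α // b ≠ a} => of b.1) y, ?_⟩
      have h : (g.comp f).comp (FreeGroup.lift (fun b : {b : α // b ≠ a} => of b.1)) =
          MonoidHom.id _ := by
        ext b
        simp only [MonoidHom.comp_apply, lift_apply_of, hgf]
        rw [hφ, substitute_of_ne b.2, hπ_of]
        rfl
      exact DFunLike.congr_fun h y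
    exact Function.Surjective.of_comp this
  obtain ⟨hfin, hle⟩ := finite_and_card_le_of_surjective f hf
  obtain ⟨-, hle'⟩ := finite_and_card_le_of_surjective g hg
  have hcard : Nat.card {b : α // b ≠ a} + 1 = Nat.card α := by
    have := Fintype.ofFinite α
    rw [Nat.card_eq_fintype_card, Nat.card_eq_fintype_card, Fintype.card_subtype_compl,
      Fintype.card_subtype_eq]
    have : 0 < Fintype.card α := Fintype.card_pos_iff.2 ⟨a⟩
    omega
  rcases hle.lt_or_eq with hlt | heq
  · right
    -- In the smaller rank `π` is injective on the image. Both `w` and `substitute a 1 w` lie in the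
    -- image and agree under `π`.
    have hinj := injective_of_surjective (by omega) g hg
    have hπρ : π (substitute a 1 w) = π w := by
      have : π.comp (substitute a 1) = π := by
        ext b
        by_cases h : b = a
        · subst h; simp [π]
        · simp [substitute_of_ne h]
      exact DFunLike.congr_fun this w
    have h1 : f (substitute a 1 w) = f (of a) := by
      apply hinj
      rw [hgf, hgf, hφ, substitute_substitute_one, substitute_of_self, hπρ]
    have h2 : φ (substitute a 1 w) = φ (of a) := by
      have := e.injective h1
      simpa using congrArg Subtype.val this
    rwa [hφ, substitute_substitute_one, substitute_of_self] at h2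
  · left
    have hinj := injective_of_surjective heq.symm f hf
    intro x y hxy
    exact hinj (by simp only [f, MonoidHom.comp_apply]; congr 1; exact Subtype.ext hxy)

/-- In the non-injective case `w` does not involve `a`, so all iterates from the first on equal `w`.
-/
theorem iterate_substitute_ne_one [Finite α] (a : α) {w : FreeGroup α} (hw : w ≠ 1) (n : ℕ) :
    (substitute a w)^[n] (of a) ≠ 1 := by
  rcases substitute_injective_or a w with h | h
  · intro h1
    refine of_ne_one a ((h.iterate n) ?_)
    rw [h1, iterate_map_one]
  · have hfix : substitute a w w = w := by
      conv_lhs => rw [← h]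
      rw [substitute_substitute_one, h]
    cases n with
    | zero => exact of_ne_one a
    | succ n =>
      rw [Function.iterate_succ_apply, substitute_of_self, Function.iterate_fixed hfix]
      exact hw

theorem norm_substitute_le (a : α) (w g : FreeGroup α) {l : ℕ} (hl : 1 ≤ l) (hw : w.norm ≤ l) :
    (substitute a w g).norm ≤ l * g.norm := by
  have hletter : ∀ c : α × Bool, (substitute a w (mk [c])).norm ≤ l := by
    have hgen : ∀ b, (substitute a w (of b)).norm ≤ l := fun b => by
      by_cases h : b = a
      · rw [h, substitute_of_self]; exact hw
      · rw [substitute_of_ne h, norm_of]; exact hl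
    rintro ⟨b, _ | _⟩
    · have : (mk [(b, false)] : FreeGroup α) = (of b)⁻¹ := by simp [of, inv_mk, invRev]
      rw [this, _root_.map_inv, norm_inv_eq]
      exact hgen b
    · exact hgen b
  have key : ∀ L : List (α × Bool), (substitute a w (mk L)).norm ≤ l * L.length := by
    intro L
    induction L with
    | nil => simp [← one_eq_mk]
    | cons c L ih =>
      have hmul : mk (c :: L) = mk [c] * mk L := by rw [mul_mk]; rfl
      rw [hmul, _root_.map_mul, List.length_cons, mul_add, mul_one, add_comm (l * _)]
      exact (norm_mul_le _ _).trans (add_le_add (hletter c) ih)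
  conv_lhs => rw [← mk_toWord (x := g)]
  exact key _

theorem norm_iterate_substitute_le (a : α) (w : FreeGroup α) {l : ℕ} (hl : 1 ≤ l)
    (hw : w.norm ≤ l) (n : ℕ) : ((substitute a w)^[n] (of a)).norm ≤ l ^ n := by
  induction n with
  | zero => simp
  | succ n ih =>
    rw [Function.iterate_succ_apply', pow_succ, mul_comm]
    exact (norm_substitute_le a w _ hl hw).trans (Nat.mul_le_mul_left l ih)

end FreeGroup

/-! ### Word iterates as substitutions, and reduction of the number of variables. -/

section WordLemmas

variable {m : ℕ} {G H : Type*} [Group G] [Group H]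

theorem wordValue_eq_lift (w : List (Fin m × Bool)) (x : Fin m → G) :
    wordValue w x = FreeGroup.lift x (FreeGroup.mk w) := by
  rw [FreeGroup.lift_mk, wordValue]
  congr 1
  refine List.map_congr_left fun a _ => ?_
  cases a.2 <;> simp

theorem map_wordValue (f : G →* H) (w : List (Fin m × Bool)) (x : Fin m → G) :
    f (wordValue w x) = wordValue w (f ∘ x) := by
  rw [wordValue_eq_lift, wordValue_eq_lift, ← MonoidHom.comp_apply]
  congr 1
  ext i
  simp

variable [NeZero m]

theorem lift_iterate_substitute (w : List (Fin m × Bool)) (x : Fin m → G) (n : ℕ)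
    (g : FreeGroup (Fin m)) :
    FreeGroup.lift x ((FreeGroup.substitute 0 (FreeGroup.mk w))^[n] g) =
      FreeGroup.lift (Function.update x 0 (wordIterate w x n)) g := by
  induction n generalizing g with
  | zero => simp [wordIterate]
  | succ n ih =>
    rw [Function.iterate_succ_apply, ih, ← MonoidHom.comp_apply]
    congr 1
    ext i
    by_cases h : i = 0
    · subst h
      simp only [MonoidHom.comp_apply, FreeGroup.substitute_of_self, FreeGroup.lift_apply_of,
        Function.update_self, wordIterate, wordValue_eq_lift]
    · simp [FreeGroup.substitute_of_ne h, h]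

theorem wordIterate_eq_lift (w : List (Fin m × Bool)) (x : Fin m → G) (n : ℕ) :
    wordIterate w x n =
      FreeGroup.lift x ((FreeGroup.substitute 0 (FreeGroup.mk w))^[n] (FreeGroup.of 0)) := by
  rw [lift_iterate_substitute, FreeGroup.lift_apply_of, Function.update_self]

/-- If `w` acts on `x 0` as an injective endomorphism fixing the other `x i`, then the iterates of
`w` at `x` stay nontrivial. -/
theorem wordIterate_ne_one_of_eq_endomorphism {w : List (Fin m × Bool)} {x : Fin m → G}
    (Φ : G →* G) (hΦ : Function.Injective Φ) (hfix : ∀ i, i ≠ 0 → Φ (x i) = x i)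
    (h : wordValue w x = Φ (x 0)) (hne : x 0 ≠ 1) (n : ℕ) : wordIterate w x n ≠ 1 := by
  have hsucc : ∀ n, wordIterate w x (n + 1) = Φ (wordIterate w x n) := by
    intro n
    induction n with
    | zero => simpa [wordIterate] using h
    | succ n ih =>
      change wordValue w (Function.update x 0 (wordIterate w x (n + 1))) =
        Φ (wordValue w (Function.update x 0 (wordIterate w x n)))
      rw [ih, map_wordValue]
      congr 1
      funext i
      by_cases hi : i = 0
      · subst hi; simp
      · simp [hi, hfix i hi]
  induction n with
  | zero => exact hne
  | succ n ih =>
    rw [hsucc]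
    exact fun h1 => ih (hΦ (h1.trans (map_one Φ).symm))

/-- A word of length `l` may be rewritten in `l + 1` variables. -/
theorem exists_word_few_variables (w : List (Fin m × Bool)) (hw : FreeGroup.mk w ≠ 1) :
    ∃ w' : List (Fin (w.length + 1) × Bool), w'.length = w.length ∧ FreeGroup.mk w' ≠ 1 ∧
      ∀ (G : Type) [Group G], SatisfiesIteratedIdentity G w → SatisfiesIteratedIdentity G w' := by
  -- Prepending `0` keeps the first variable first even if `w` does not contain it. The minimum in
  -- `ι` only makes it total; it changes nothing on members of `L`.
  set L : List (Fin m) := 0 :: w.map Prod.fst with hL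
  have hlen : L.length = w.length + 1 := by simp [hL]
  let ι : Fin m → Fin (w.length + 1) := fun i =>
    ⟨min (L.idxOf i) w.length, Nat.lt_succ_of_le (min_le_right _ _)⟩
  let ν : Fin (w.length + 1) → Fin m := fun k => L[(k : ℕ)]'(by rw [hlen]; exact k.2)
  have hνι : ∀ i ∈ L, ν (ι i) = i := by
    intro i hi
    have h1 : L.idxOf i < L.length := List.idxOf_lt_length_iff.2 hi
    have h2 : ((ι i : Fin (w.length + 1)) : ℕ) = L.idxOf i := min_eq_left (by omega)
    simp only [ν, h2]
    exact List.getElem_idxOf h1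
  have hι0 : ι 0 = 0 := by
    ext
    simp [ι, hL]
  have hmem : ∀ a ∈ w, a.1 ∈ L := fun a ha => List.mem_cons_of_mem _ (List.mem_map_of_mem ha)
  have h0 : (0 : Fin m) ∈ L := List.mem_cons_self
  refine ⟨w.map (Prod.map ι id), by simp, fun h => hw ?_, fun G _ hG x => ?_⟩
  · have h1 := congrArg (FreeGroup.map ν) h
    rw [FreeGroup.map.mk, map_one, List.map_map] at h1
    rw [← h1]
    congr 1
    conv_lhs => rw [← List.map_id w]
    refine List.map_congr_left fun a ha => ?_
    ext
    · simp [hνι _ (hmem a ha)]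
    · simp
  · obtain ⟨n, hn, h1⟩ := hG (x ∘ ι)
    refine ⟨n, hn, ?_⟩
    rw [← h1]
    clear hn h1
    induction n with
    | zero => simp [wordIterate, hι0]
    | succ n ih =>
      rw [wordIterate, wordIterate, ih, wordValue, wordValue, List.map_map]
      congr 1
      refine List.map_congr_left fun a ha => ?_
      have key : Function.update x 0 (wordIterate w (x ∘ ι) n) (ι a.1) =
          Function.update (x ∘ ι) 0 (wordIterate w (x ∘ ι) n) a.1 := by
        by_cases hi : a.1 = 0
        · rw [hi, hι0, Function.update_self, Function.update_self]
        · have : ι a.1 ≠ 0 := fun h2 => hi (by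
            rw [← hνι _ (hmem a ha), h2, ← hι0, hνι _ h0])
          rw [Function.update_of_ne this, Function.update_of_ne hi]
          rfl
      simp only [Function.comp_apply, Prod.map_fst, Prod.map_snd, id, key]

end WordLemmas

/-! ### Words evaluated at arbitrary 2 × 2 matrices. -/

section MatrixWord

open Matrix

variable {m : ℕ} {R S : Type*} [CommRing R] [CommRing S]

/-- The value of a word at `2 × 2` matrices, where inverse letters stand for adjugates. -/
def matrixWord (w : List (Fin m × Bool)) (x : Fin m → Matrix (Fin 2) (Fin 2) R) :
    Matrix (Fin 2) (Fin 2) R :=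
  (w.map fun a => if a.2 then x a.1 else adjugate (x a.1)).prod

theorem coe_wordValue (w : List (Fin m × Bool)) (x : Fin m → SpecialLinearGroup (Fin 2) R) :
    ((wordValue w x : SpecialLinearGroup (Fin 2) R) : Matrix (Fin 2) (Fin 2) R) =
      matrixWord w fun i => (x i : Matrix (Fin 2) (Fin 2) R) := by
  induction w with
  | nil => simp [wordValue, matrixWord]
  | cons a w ih =>
    have hcons : wordValue (a :: w) x = (if a.2 then x a.1 else (x a.1)⁻¹) * wordValue w x := by
      rw [wordValue, List.map_cons, List.prod_cons, wordValue]
    have hcons' : matrixWord (a :: w) (fun i => (x i : Matrix (Fin 2) (Fin 2) R)) =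
        (if a.2 then (x a.1 : Matrix (Fin 2) (Fin 2) R) else adjugate (x a.1)) *
          matrixWord w fun i => (x i : Matrix (Fin 2) (Fin 2) R) := by
      rw [matrixWord, List.map_cons, List.prod_cons, matrixWord]
    rw [hcons, hcons', ← ih]
    cases a.2 <;> rfl

theorem mapMatrix_matrixWord (f : R →+* S) (w : List (Fin m × Bool))
    (x : Fin m → Matrix (Fin 2) (Fin 2) R) :
    f.mapMatrix (matrixWord w x) = matrixWord w fun i => f.mapMatrix (x i) := by
  rw [matrixWord, matrixWord, map_list_prod, List.map_map]
  congr 1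
  refine List.map_congr_left fun a _ => ?_
  rw [Function.comp_apply, apply_ite f.mapMatrix, RingHom.map_adjugate]

/-- The adjugate of a 2 × 2 matrix is linear in it, so a letter and its inverse both contribute one
factor `s`. -/
theorem exists_matrixWord_update_smul (w : List (Fin m × Bool)) (i : Fin m) : ∃ N : ℕ,
    ∀ (x : Fin m → Matrix (Fin 2) (Fin 2) R) (s : R) (y : Matrix (Fin 2) (Fin 2) R),
      matrixWord w (Function.update x i (s • y)) =
        s ^ N • matrixWord w (Function.update x i y) := by
  induction w with
  | nil => exact ⟨0, by simp [matrixWord]⟩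
  | cons a w ih =>
    obtain ⟨N, hN⟩ := ih
    have hcons : ∀ x : Fin m → Matrix (Fin 2) (Fin 2) R, matrixWord (a :: w) x =
        (if a.2 then x a.1 else adjugate (x a.1)) * matrixWord w x := fun x => by
      rw [matrixWord, List.map_cons, List.prod_cons, matrixWord]
    by_cases h : a.1 = i
    · refine ⟨N + 1, fun x s y => ?_⟩
      rw [hcons, hcons, hN, h, Function.update_self, Function.update_self]
      cases a.2 <;> simp [adjugate_smul, smul_smul, pow_succ]
    · refine ⟨N, fun x s y => ?_⟩
      rw [hcons, hcons, hN, Function.update_of_ne h, Function.update_of_ne h, mul_smul_comm]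

open MvPolynomial in
theorem totalDegree_matrixWord_le {σ : Type*} (w : List (Fin m × Bool))
    {x : Fin m → Matrix (Fin 2) (Fin 2) (MvPolynomial σ R)}
    (hx : ∀ k i j, (x k i j).totalDegree ≤ 1) (i j : Fin 2) :
    (matrixWord w x i j).totalDegree ≤ w.length := by
  induction w generalizing i j with
  | nil =>
    rw [matrixWord, List.map_nil, List.prod_nil, one_apply]
    split_ifs <;> simp
  | cons a w ih =>
    have hcons : matrixWord (a :: w) x =
        (if a.2 then x a.1 else adjugate (x a.1)) * matrixWord w x := by
      rw [matrixWord, List.map_cons, List.prod_cons, matrixWord]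
    have ha : ∀ i j, ((if a.2 then x a.1 else adjugate (x a.1)) i j).totalDegree ≤ 1 := by
      intro i j
      cases a.2
      · rw [adjugate_fin_two]
        fin_cases i <;> fin_cases j <;> simpa [totalDegree_neg] using hx _ _ _
      · exact hx _ _ _
    rw [hcons, mul_apply, List.length_cons]
    refine totalDegree_finsetSum_le fun k _ => (totalDegree_mul _ _).trans ?_
    have := ha i k
    have := ih k j
    omega

end MatrixWord

/-! ### The polynomial map of a word and the field `K`. -/

section FieldConstruction

open Matrix MvPolynomial

variable {m : ℕ} [NeZero m] {F : Type*} [Field F]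

/-- The polynomials giving the entries of the value of `w` at a generic matrix and fixed matrices
`a i` for `i ≠ 0`. -/
noncomputable def wordPolynomial (w : List (Fin m × Bool))
    (a : Fin m → SpecialLinearGroup (Fin 2) F) (ij : Fin 2 × Fin 2) :
    MvPolynomial (Fin 2 × Fin 2) F :=
  matrixWord w (Function.update (fun k => (a k).1.map C) 0 (mvPolynomialX (Fin 2) (Fin 2) F))
    ij.1 ij.2

theorem totalDegree_wordPolynomial_le (w : List (Fin m × Bool))
    (a : Fin m → SpecialLinearGroup (Fin 2) F) (ij : Fin 2 × Fin 2) :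
    (wordPolynomial w a ij).totalDegree ≤ w.length := by
  refine totalDegree_matrixWord_le w (fun k i j => ?_) _ _
  by_cases h : k = 0
  · subst h
    simp [mvPolynomialX_apply]
  · simp [h]

theorem aeval_wordPolynomial {K : Type*} [CommRing K] [Algebra F K] (w : List (Fin m × Bool))
    (a : Fin m → SpecialLinearGroup (Fin 2) F) (y : Matrix (Fin 2) (Fin 2) K)
    (ij : Fin 2 × Fin 2) :
    aeval (fun kl : Fin 2 × Fin 2 => y kl.1 kl.2) (wordPolynomial w a ij) =
      matrixWord w (Function.update (fun k => (a k).1.map (algebraMap F K)) 0 y) ij.1 ij.2 := by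
  set f : MvPolynomial (Fin 2 × Fin 2) F →ₐ[F] K :=
    aeval fun kl : Fin 2 × Fin 2 => y kl.1 kl.2 with hf
  change f.toRingHom.mapMatrix (matrixWord w _) ij.1 ij.2 = _
  rw [mapMatrix_matrixWord]
  congr 2
  funext k
  ext i j
  by_cases h : k = 0
  · subst h
    simp [hf, mvPolynomialX_apply]
  · simp [h, hf]

/-- Composing with the word map shifts the iterate by one. Hence one point whose fourth iterate has
a nonzero upper right entry shows that the fourth composite is a nonzero polynomial. -/
theorem aeval_iterate_bind₁_wordPolynomial (w : List (Fin m × Bool))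
    (a : Fin m → SpecialLinearGroup (Fin 2) F) (h : MvPolynomial (Fin 2 × Fin 2) F) (n j : ℕ) :
    aeval (fun kl : Fin 2 × Fin 2 => (wordIterate w a j).1 kl.1 kl.2)
        ((bind₁ (wordPolynomial w a))^[n] h) =
      aeval (fun kl : Fin 2 × Fin 2 => (wordIterate w a (j + n)).1 kl.1 kl.2) h := by
  induction n generalizing j with
  | zero => rfl
  | succ n ih =>
    have hstep : (fun ij => aeval (fun kl : Fin 2 × Fin 2 => (wordIterate w a j).1 kl.1 kl.2)
        (wordPolynomial w a ij)) =
        fun kl : Fin 2 × Fin 2 => (wordIterate w a (j + 1)).1 kl.1 kl.2 := by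
      funext ij
      rw [aeval_wordPolynomial]
      change _ = ((wordValue w (Function.update a 0 (wordIterate w a j)) :
        SpecialLinearGroup (Fin 2) F) : Matrix (Fin 2) (Fin 2) F) ij.1 ij.2
      rw [coe_wordValue]
      congr 2
      funext k
      by_cases hk : k = 0
      · subst hk; simp
      · simp only [Function.update_of_ne hk]
        ext i j
        simp
    rw [Function.iterate_succ_apply', aeval_bind₁, hstep, ih, add_right_comm, add_assoc]

/-- The determinant times the upper right entry of a generic matrix. -/
noncomputable def detMulEntry (F : Type*) [Field F] : MvPolynomial (Fin 2 × Fin 2) F :=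
  (mvPolynomialX (Fin 2) (Fin 2) F).det * X (0, 1)

theorem totalDegree_detMulEntry_le : (detMulEntry F).totalDegree ≤ 3 := by
  refine (totalDegree_mul _ _).trans ?_
  rw [totalDegree_X, det_fin_two]
  refine Nat.succ_le_succ ((totalDegree_sub _ _).trans (max_le ?_ ?_)) <;>
  · refine (totalDegree_mul _ _).trans ?_
    simp [mvPolynomialX_apply]

theorem aeval_detMulEntry {K : Type*} [CommRing K] [Algebra F K] (y : Matrix (Fin 2) (Fin 2) K) :
    aeval (fun kl : Fin 2 × Fin 2 => y kl.1 kl.2) (detMulEntry F) = y.det * y 0 1 := by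
  simp [detMulEntry, det_fin_two, mvPolynomialX_apply]

/-- A matrix with nonzero determinant and nonzero upper right entry whose entrywise Frobenius image
is its image under the word map gives, in characteristic two, a point of `SL₂` violating the
iterated identity. -/
theorem not_satisfies_of_frobenius [Fintype F] [CharP F 2] {K : Type*} [Field K] [Finite K]
    [Algebra F K] (w : List (Fin m × Bool)) (a : Fin m → SpecialLinearGroup (Fin 2) F)
    (y : Matrix (Fin 2) (Fin 2) K) (hdet : y.det ≠ 0) (hentry : y 0 1 ≠ 0)
    (hy : y.map (FiniteField.frobeniusAlgHom F K) =
      matrixWord w (Function.update (fun k => (a k).1.map (algebraMap F K)) 0 y)) :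
    ¬ SatisfiesIteratedIdentity (SpecialLinearGroup (Fin 2) K) w := by
  have : CharP K 2 := charP_of_injective_algebraMap (algebraMap F K).injective 2
  set φ := FiniteField.frobeniusAlgHom F K with hφ
  obtain ⟨s, hs⟩ := isSquare_of_charTwo' (y.det)⁻¹
  have hs1 : s ^ 2 * y.det = 1 := by rw [pow_two, ← hs, inv_mul_cancel₀ hdet]
  have hs0 : s ≠ 0 := by
    rintro rfl
    simp at hs1
  have hz : (s • y).det = 1 := by rw [det_smul, Fintype.card_fin, hs1]
  let z : SpecialLinearGroup (Fin 2) K := ⟨s • y, hz⟩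
  let x : Fin m → SpecialLinearGroup (Fin 2) K :=
    Function.update (fun k => SpecialLinearGroup.map (algebraMap F K) (a k)) 0 z
  have hx0 : x 0 = z := Function.update_self ..
  obtain ⟨N, hN⟩ := exists_matrixWord_update_smul (R := K) w 0
  have hcoe : (fun k => (x k : Matrix (Fin 2) (Fin 2) K)) =
      Function.update (fun k => (a k).1.map (algebraMap F K)) 0 (s • y) := by
    funext k
    by_cases hk : k = 0
    · subst hk
      rw [hx0, Function.update_self]
    · simp only [x, Function.update_of_ne hk]
      rfl
  have hval : ((wordValue w x : SpecialLinearGroup (Fin 2) K) : Matrix (Fin 2) (Fin 2) K) =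
      s ^ N • y.map φ := by
    rw [coe_wordValue, hcoe, hN, hy]
  have hΦ : ((SpecialLinearGroup.map (φ : K →+* K) z : SpecialLinearGroup (Fin 2) K) :
      Matrix (Fin 2) (Fin 2) K) = φ s • y.map φ := by
    ext i j
    exact map_mul φ s (y i j)
  have hdetφ : (y.map φ).det ≠ 0 := by
    have : (y.map φ).det = φ y.det := by rw [AlgHom.map_det]; rfl
    rw [this]
    exact (map_ne_zero φ).2 hdet
  -- Both `s ^ N • φ(y)` and `φ(s) • φ(y)` have determinant one, so the two scalars have equal
  -- squares, hence are equal in characteristic two.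
  have hsN : s ^ N = φ s := by
    have h1 := (wordValue w x).det_coe
    have h2 := (SpecialLinearGroup.map (φ : K →+* K) z).det_coe
    rw [hval, det_smul, Fintype.card_fin] at h1
    rw [hΦ, det_smul, Fintype.card_fin] at h2
    exact CharTwo.sq_injective (mul_right_cancel₀ hdetφ (h1.trans h2.symm))
  intro hsat
  obtain ⟨n, -, hn⟩ := hsat x
  refine wordIterate_ne_one_of_eq_endomorphism (SpecialLinearGroup.map (φ : K →+* K)) ?_ ?_ ?_ ?_ n hn
  · intro u v huv
    ext i j
    have := congrArg (fun t : SpecialLinearGroup (Fin 2) K => t.1 i j) huv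
    exact φ.injective this
  · intro k hk
    ext i j
    simp [x, hk]
  · rw [hx0]
    apply Subtype.ext
    exact hval.trans ((congrArg (· • y.map φ) hsN).trans hΦ.symm)
  · intro h
    rw [hx0] at h
    have := congrArg (fun t : SpecialLinearGroup (Fin 2) K => t.1 0 1) h
    simp [z, hs0, hentry] at this

/-- A nontrivial word in few variables is not an iterated identity of `SL₂` over some finite field
of controlled size. -/
theorem exists_field_of_few_variables (w : List (Fin m × Bool)) (hw : FreeGroup.mk w ≠ 1)
    (hm : m ≤ w.length + 1) : ∃ (q : ℕ) (K : Type) (_ : Field K),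
      q ≤ 2 * (15 * w.length ^ 4) ^ 5 ∧ Finite K ∧ Nat.card K ≤ q ^ q ^ 4 ∧
      ¬ SatisfiesIteratedIdentity (SpecialLinearGroup (Fin 2) K) w := by
  set l := w.length with hl
  have hl1 : 1 ≤ l := by
    rw [hl, Nat.one_le_iff_ne_zero, Ne, List.length_eq_zero_iff]
    rintro rfl
    exact hw rfl
  have hl4 : l ≤ l ^ 4 := Nat.le_self_pow (by norm_num) l
  have hB4 : 15 * l ^ 4 ≤ (15 * l ^ 4) ^ 5 := Nat.le_self_pow (by norm_num) _
  -- The bound is `((n + 1) * (r * d ^ n)) ^ (n + 1)` with `n = 4`, `r = 3`, `d = l`. It also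
  -- exceeds the `2 * m` slopes needed and the norm `l ^ 4` of the fourth iterate.
  obtain ⟨F, _, _, hlt, hle⟩ := exists_finite_field_charTwo ((15 * l ^ 4) ^ 5) (by omega)
  have : Finite F := Nat.finite_of_card_ne_zero (by omega)
  have : Fintype F := Fintype.ofFinite F
  obtain ⟨κ, hκ⟩ := Function.exists_injective_of_card_le (A := Fin m × Bool) (B := F) (by
    have : Nat.card (Fin m × Bool) = m * 2 := by simp
    omega)
  have hnorm := FreeGroup.norm_iterate_substitute_le 0 (FreeGroup.mk w) hl1 FreeGroup.norm_mk_le 4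
  obtain ⟨a, ha⟩ := FreeGroupMatrix.exists_lift_entry_ne_zero hκ
    (FreeGroup.iterate_substitute_ne_one 0 hw 4) (by omega)
  rw [← wordIterate_eq_lift] at ha
  have hcard : Fintype.card (Fin 2 × Fin 2) = 4 := rfl
  have hne : (bind₁ (wordPolynomial w a))^[Fintype.card (Fin 2 × Fin 2)] (detMulEntry F) ≠ 0 := by
    intro h
    have h1 := aeval_iterate_bind₁_wordPolynomial w a (detMulEntry F) 4 0
    rw [hcard] at h
    rw [h, map_zero, aeval_detMulEntry, zero_add] at h1
    rw [(wordIterate w a 4).2, one_mul] at h1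
    exact ha h1.symm
  obtain ⟨hPq, I, hI, hmem, hnot⟩ := FrobeniusTwist.exists_maximal_notMem hl1 (by norm_num)
    (totalDegree_wordPolynomial_le w a) totalDegree_detMulEntry_le hne (by
      rw [hcard, ← Nat.card_eq_fintype_card]
      calc ((4 + 1) * (3 * l ^ 4)) ^ (4 + 1) = (15 * l ^ 4) ^ 5 := by ring
        _ < _ := hlt)
  obtain ⟨hfin, hKcard⟩ := FrobeniusTwist.finite_quotient_and_card_le hPq hmem
  let := Ideal.Quotient.field I
  refine ⟨Nat.card F, MvPolynomial (Fin 2 × Fin 2) F ⧸ I, inferInstance, hle, hfin, ?_, ?_⟩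
  · rwa [hcard, ← Nat.card_eq_fintype_card] at hKcard
  let y : Matrix (Fin 2) (Fin 2) (MvPolynomial (Fin 2 × Fin 2) F ⧸ I) :=
    Matrix.of fun i j => Ideal.Quotient.mk I (X (i, j))
  have hmk : ∀ g, Ideal.Quotient.mk I g = aeval (fun kl : Fin 2 × Fin 2 => y kl.1 kl.2) g := by
    intro g
    have : Ideal.Quotient.mkₐ F I = aeval (fun kl : Fin 2 × Fin 2 => y kl.1 kl.2) := by
      refine algHom_ext fun i => ?_
      simp [y]
    exact AlgHom.congr_fun this g
  have hprod : y.det * y 0 1 ≠ 0 := by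
    rw [← aeval_detMulEntry (F := F), ← hmk]
    exact fun h => hnot (Ideal.Quotient.eq_zero_iff_mem.1 h)
  refine not_satisfies_of_frobenius w a y (left_ne_zero_of_mul hprod) (right_ne_zero_of_mul hprod) ?_
  ext i j
  rw [← aeval_wordPolynomial w a y (i, j), ← hmk]
  have := Ideal.Quotient.eq.2 (hmem (i, j))
  rw [map_pow] at this
  exact this

end FieldConstruction

/-! ### Explicit size bounds and short words. -/

section Bounds

theorem not_satisfies_of_length_one {m : ℕ} [NeZero m] {G : Type*} [Group G]
    {w : List (Fin m × Bool)} (hw : w.length = 1) {g : G} (hg : g⁻¹ = g) (hne : g ≠ 1) :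
    ¬ SatisfiesIteratedIdentity G w := by
  obtain ⟨a, rfl⟩ := List.length_eq_one_iff.1 hw
  have h : ∀ n, wordIterate [a] (fun _ => g) n = g := by
    intro n
    induction n with
    | zero => rfl
    | succ n ih => rw [wordIterate, ih]; simp [wordValue, hg]
  intro hsat
  obtain ⟨n, -, hn⟩ := hsat fun _ => g
  exact hne ((h n).symm.trans hn)

theorem natCard_specialLinearGroup_two_le (K : Type*) [Field K] [Finite K] :
    Nat.card (Matrix.SpecialLinearGroup (Fin 2) K) ≤ Nat.card K ^ 4 := by
  refine (Nat.card_le_card_of_injective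
    (fun A : Matrix.SpecialLinearGroup (Fin 2) K => fun i : Fin 2 × Fin 2 => A.1 i.1 i.2) ?_).trans_eq ?_
  · intro A B h
    ext i j
    exact congrFun h (i, j)
  · rw [Nat.card_fun]
    simp

/-- Here `k ^ 4` bounds the order of `SL₂` of a field with `k` elements. Since `l ≥ 2` absorbs the
constants, `q ≤ l ^ 41`; then `q ^ (4 * q ^ 4) ≤ exp (4 * q ^ 5)` and `2 + 5 * 41 = 207`. -/
theorem pow_pow_four_le_exp {l q k : ℕ} (hl : 2 ≤ l) (hq : q ≤ 2 * (15 * l ^ 4) ^ 5)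
    (hk : k ≤ q ^ q ^ 4) : ((k ^ 4 : ℕ) : ℝ) ≤ Real.exp ((l : ℝ) ^ (207 : ℝ)) := by
  have hql : q ≤ l ^ 41 := by
    calc q ≤ 2 * (15 * l ^ 4) ^ 5 := hq
      _ = 2 * 15 ^ 5 * l ^ 20 := by ring
      _ ≤ 2 ^ 21 * l ^ 20 := Nat.mul_le_mul_right _ (by norm_num)
      _ ≤ l ^ 21 * l ^ 20 := Nat.mul_le_mul_right _ (Nat.pow_le_pow_left hl 21)
      _ = l ^ 41 := by ring
  have h4 : q ^ 4 * 4 * q ≤ l ^ 207 := by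
    calc q ^ 4 * 4 * q = 2 ^ 2 * q ^ 5 := by ring
      _ ≤ l ^ 2 * (l ^ 41) ^ 5 :=
        Nat.mul_le_mul (Nat.pow_le_pow_left hl 2) (Nat.pow_le_pow_left hql 5)
      _ = l ^ 207 := by ring
  have hk4 : k ^ 4 ≤ q ^ (q ^ 4 * 4) := by
    rw [pow_mul]
    exact Nat.pow_le_pow_left hk 4
  have hexp : (q : ℝ) ≤ Real.exp q := by
    have := Real.add_one_le_exp (q : ℝ)
    linarith
  have h207 : (l : ℝ) ^ (207 : ℝ) = ((l ^ 207 : ℕ) : ℝ) := by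
    rw [Nat.cast_pow, ← Real.rpow_natCast]
    norm_num
  rw [h207]
  calc ((k ^ 4 : ℕ) : ℝ) ≤ ((q ^ (q ^ 4 * 4) : ℕ) : ℝ) := Nat.cast_le.2 hk4
    _ = (q : ℝ) ^ (q ^ 4 * 4) := Nat.cast_pow _ _
    _ ≤ Real.exp q ^ (q ^ 4 * 4) := pow_le_pow_left₀ (Nat.cast_nonneg q) hexp _
    _ = Real.exp ((q ^ 4 * 4 * q : ℕ) : ℝ) := by
      rw [← Real.exp_nat_mul]
      push_cast
      ring_nf
    _ ≤ _ := Real.exp_le_exp.2 (Nat.cast_le.2 h4)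

theorem exists_field_not_satisfies {m : ℕ} [NeZero m] (w : List (Fin m × Bool))
    (hw : FreeGroup.mk w ≠ 1) :
    ∃ (K : Type) (_ : Field K), Finite K ∧
      ¬ SatisfiesIteratedIdentity (Matrix.SpecialLinearGroup (Fin 2) K) w ∧
      (Nat.card K : ℝ) ≤ Real.exp ((w.length : ℝ) ^ (207 : ℝ)) ∧
      (2 ≤ w.length → (Nat.card (Matrix.SpecialLinearGroup (Fin 2) K) : ℝ) ≤
        Real.exp ((w.length : ℝ) ^ (207 : ℝ))) := by
  have hl0 : w.length ≠ 0 := by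
    rw [Ne, List.length_eq_zero_iff]
    rintro rfl
    exact hw rfl
  by_cases hl : w.length = 1
  -- For length one the bound is `e < 3`, which forces the field with two elements; its `SL₂` has
  -- six elements and is too large.
  · refine ⟨ZMod 2, inferInstance, inferInstance, ?_, ?_, fun h => by omega⟩
    · exact not_satisfies_of_length_one hl
        (g := (⟨!![1, 1; 0, 1], by decide⟩ : Matrix.SpecialLinearGroup (Fin 2) (ZMod 2)))
        (Subtype.ext (by decide)) (fun h => absurd (congrArg Subtype.val h) (by decide))
    · have := Real.add_one_le_exp (1 : ℝ)
      simp [hl]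
      linarith
  · obtain ⟨w', hlen, hw', himp⟩ := exists_word_few_variables w hw
    obtain ⟨q, K, _, hq, hfin, hcard, hsat⟩ := exists_field_of_few_variables w' hw' (by omega)
    rw [hlen] at hq
    have hl2 : 2 ≤ w.length := by omega
    have hbound := pow_pow_four_le_exp hl2 hq hcard
    refine ⟨K, inferInstance, hfin, fun h => hsat (himp _ h), ?_, fun _ => ?_⟩
    · exact (Nat.cast_le.2 (Nat.le_self_pow (by norm_num) _)).trans hbound
    · exact (Nat.cast_le.2 (natCard_specialLinearGroup_two_le K)).trans hbound

end Bounds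

theorem theorem1 :
    (∀ (m : ℕ) [NeZero m] (w : List (Fin m × Bool)), FreeGroup.mk w ≠ 1 →
      ∃ (G : Type) (_ : Group G), Finite G ∧ ¬ SatisfiesIteratedIdentity G w) ∧
    ∃ C : ℝ, 0 < C ∧
      ∀ (m : ℕ) [NeZero m] (w : List (Fin m × Bool)), FreeGroup.mk w ≠ 1 →
        (∃ (G : Type) (_ : Group G), Finite G ∧ ¬ SatisfiesIteratedIdentity G w ∧
          (Nat.card G : ℝ) ≤ Real.exp ((w.length : ℝ) ^ C)) ∧
        (∃ (K : Type) (_ : Field K), Finite K ∧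
          ¬ SatisfiesIteratedIdentity (Matrix.SpecialLinearGroup (Fin 2) K) w ∧
          (Nat.card K : ℝ) ≤ Real.exp ((w.length : ℝ) ^ C) ∧
          (2 ≤ w.length → (Nat.card (Matrix.SpecialLinearGroup (Fin 2) K) : ℝ) ≤
            Real.exp ((w.length : ℝ) ^ C))) := by
  refine ⟨fun m _ w hw => ?_, 207, by norm_num, fun m _ w hw => ⟨?_, ?_⟩⟩
  · obtain ⟨K, _, _, hsat, -, -⟩ := exists_field_not_satisfies w hw
    exact ⟨Matrix.SpecialLinearGroup (Fin 2) K, inferInstance, Subtype.finite, hsat⟩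
  · by_cases hl : 2 ≤ w.length
    · obtain ⟨K, _, _, hsat, -, hcard⟩ := exists_field_not_satisfies w hw
      exact ⟨Matrix.SpecialLinearGroup (Fin 2) K, inferInstance, Subtype.finite, hsat, hcard hl⟩
    · have hl0 : w.length ≠ 0 := by
        rw [Ne, List.length_eq_zero_iff]
        rintro rfl
        exact hw rfl
      have hl1 : w.length = 1 := by omega
      -- Only a group of order two fits below `e`; its nontrivial element is its own inverse, so a
      -- single letter never moves it.
      refine ⟨Multiplicative (ZMod 2), inferInstance, inferInstance,
        not_satisfies_of_length_one hl1 (g := Multiplicative.ofAdd 1) (by decide) (by decide), ?_⟩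
      have := Real.add_one_le_exp (1 : ℝ)
      simp [hl1]
      linarith
  · exact exists_field_not_satisfies w hw
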